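/- The Hoffman–Singleton graph is strongly regular with parameters $(50,7,0,1)$, has smallest eigenvalue $-3$, and is not $2$-integrable. More precisely: Let $HoSi$ be the graph on the $50$ vertices $p_{j,a}, q_{i,l}$ ($i,j,a,l\in\mathbb Z/5\mathbb Z$) in which $p_{j,a}\sim p_{j,a\pm1}$, $q_{i,l}\sim q_{i,l\pm2}$, $q_{i,l}\sim p_{j,ij+l}$ for all $i,j,a,l$, and there are no other adjacencies (Robertson's construction of the Hoffman–Singleton graph). Then $HoSi$ is strongly regular with parameters $(50,7,0,1)$. Moreover every strongly regular graph $G$ with parameters $(50,7,0,1)$ has smallest eigenvalue $-3$ and is not $2$-integrable. Here $\theta_{\min}(G)$ is the smallest eigenvalue of the adjacency matrix of the finite graph $G$. A representation of norm $t$ of $G$ is a map $\varphi:V(G)\to\mathbb R^n$ with $(\varphi(x),\varphi(y))$ equal to $t$ if $x=y$, to $1$ if $x\sim y$, and to $0$ otherwise. The graph $G$ is $s$-integrable ($s$ a positive integer) if, for a representation $\varphi$ of $G$ of norm $-\lfloor\theta_{\min}(G)\rfloor$ and the lattice $\Lambda=\{\sum_x a_x\varphi(x)\mid a_x\in\mathbb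 Z\}$ that it generates, $\sqrt s\,\Lambda$ embeds in a standard lattice $\mathbb Z^m$ by an additive map preserving inner products; such a $\varphi$ always exists, and the property does not depend on its choice. -/

import Mathlib

open scoped Matrix Pointwise

namespace SimpleGraph

/-- The eigenvalues of a finite graph: the eigenvalues of its (real) adjacency matrix. -/
def graphEigenvalues {V : Type*} [Fintype V] [DecidableEq V] (G : SimpleGraph V)
    [DecidableRel G.Adj] : Set ℝ :=
  {θ | Module.End.HasEigenvalue (Matrix.toLin' (G.adjMatrix ℝ)) θ}

/-- The smallest eigenvalue of a finite graph. For a graph with at least one vertex the set of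
eigenvalues is finite and nonempty, so the infimum is a minimum. -/
noncomputable def minEigenvalue {V : Type*} [Fintype V] [DecidableEq V] (G : SimpleGraph V)
    [DecidableRel G.Adj] : ℝ :=
  sInf G.graphEigenvalues

/-- `φ` is a representation of norm `t` of the graph `G`, in the Euclidean space `ℝⁿ`:
`(φ x, φ y)` is `t` if `x = y`, is `1` if `x ∼ y`, and is `0` otherwise. -/
structure IsRepresentation {V : Type*} (G : SimpleGraph V) (t : ℝ) {n : ℕ}
    (φ : V → EuclideanSpace ℝ (Fin n)) : Prop where
  inner_self : ∀ x, inner ℝ (φ x) (φ x) = t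
  inner_adj : ∀ x y, G.Adj x y → inner ℝ (φ x) (φ y) = 1
  inner_not_adj : ∀ x y, x ≠ y → ¬ G.Adj x y → inner ℝ (φ x) (φ y) = 0

end SimpleGraph

/-- A lattice `Λ` in `ℝⁿ` (a finitely generated subgroup, in applications an integral one) is
`s`-integrable if `√s Λ` embeds in a standard lattice `ℤᵐ`: there is an additive map
`√s Λ → ℤᵐ` that preserves inner products (hence is injective). -/
def LatticeIsIntegrable (s : ℕ) {n : ℕ} (Λ : Submodule ℤ (EuclideanSpace ℝ (Fin n))) : Prop :=
  ∃ (m : ℕ) (f : ↥(Real.sqrt (s : ℝ) • Λ) →ₗ[ℤ] (Fin m → ℤ)),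
    ∀ u v : ↥(Real.sqrt (s : ℝ) • Λ),
      ((f u ⬝ᵥ f v : ℤ) : ℝ) =
        inner ℝ (u : EuclideanSpace ℝ (Fin n)) (v : EuclideanSpace ℝ (Fin n))

namespace SimpleGraph

/-- A finite graph `G` is `s`-integrable (`s` a positive integer) if the lattice generated by a
representation of `G` of norm `-⌊θ_min(G)⌋` is `s`-integrable. Such a representation always exists,
and the lattice does not depend on it up to isometry. -/
def IsIntegrable {V : Type*} [Fintype V] [DecidableEq V] (G : SimpleGraph V)
    [DecidableRel G.Adj] (s : ℕ) : Prop :=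
  ∃ (n : ℕ) (φ : V → EuclideanSpace ℝ (Fin n)),
    G.IsRepresentation (-(⌊G.minEigenvalue⌋ : ℝ)) φ ∧
      LatticeIsIntegrable s (Submodule.span ℤ (Set.range φ))

end SimpleGraph

/-- The adjacency relation of Robertson's pentagons and pentagrams graph. The vertex `inl (j, a)` is
the vertex `a` of the pentagon `P^j`, the vertex `inr (i, l)` is the vertex `l` of the
pentagram `Q^i`; vertex `l` of `Q^i` is joined to vertex `i * j + l` of `P^j`. -/
def robertsonAdj : (ZMod 5 × ZMod 5) ⊕ (ZMod 5 × ZMod 5) →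
    (ZMod 5 × ZMod 5) ⊕ (ZMod 5 × ZMod 5) → Prop
  | Sum.inl p, Sum.inl q => p.1 = q.1 ∧ (q.2 = p.2 + 1 ∨ p.2 = q.2 + 1)
  | Sum.inr p, Sum.inr q => p.1 = q.1 ∧ (q.2 = p.2 + 2 ∨ p.2 = q.2 + 2)
  | Sum.inl p, Sum.inr q => p.2 = q.1 * p.1 + q.2
  | Sum.inr q, Sum.inl p => p.2 = q.1 * p.1 + q.2

instance robertsonAdj_decidable : DecidableRel robertsonAdj
  | Sum.inl p, Sum.inl q => inferInstanceAs (Decidable (p.1 = q.1 ∧ (q.2 = p.2 + 1 ∨ p.2 = q.2 + 1)))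
  | Sum.inr p, Sum.inr q => inferInstanceAs (Decidable (p.1 = q.1 ∧ (q.2 = p.2 + 2 ∨ p.2 = q.2 + 2)))
  | Sum.inl p, Sum.inr q => inferInstanceAs (Decidable (p.2 = q.1 * p.1 + q.2))
  | Sum.inr q, Sum.inl p => inferInstanceAs (Decidable (p.2 = q.1 * p.1 + q.2))

/-- The Hoffman–Singleton graph, in Robertson's construction. -/
def hoffmanSingleton : SimpleGraph ((ZMod 5 × ZMod 5) ⊕ (ZMod 5 × ZMod 5)) where
  Adj := robertsonAdj
  symm := ⟨by
    rintro (p | p) (q | q) h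
    · exact ⟨h.1.symm, h.2.symm⟩
    · exact h
    · exact h
    · exact ⟨h.1.symm, h.2.symm⟩⟩
  loopless := ⟨by
    have h1 : ∀ a : ZMod 5, a ≠ a + 1 := by decide
    have h2 : ∀ a : ZMod 5, a ≠ a + 2 := by decide
    rintro (p | p) h
    · exact h.2.elim (h1 _) (h1 _)
    · exact h.2.elim (h2 _) (h2 _)⟩

instance hoffmanSingleton_decidable : DecidableRel hoffmanSingleton.Adj :=
  robertsonAdj_decidable

/-!
Let `A` be the adjacency matrix of a strongly regular graph with parameters `(50, 7, 0, 1)`. Then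
`(A + 3) (A - 2)` is the all-ones matrix, which gives the smallest eigenvalue.

If the graph is `2`-integrable, there are integer vectors `u x` with Gram matrix `2 (A + 3)`. The
vector `w = ∑ y ∼ x, u y - 2 u x` does not depend on `x`, has norm `10`, and may be taken to be
nonnegative. The key identity (`IsIntegralFrame.sum_mul_self`) is that `∑ x, u x k * u x l - w k * w l`
is `10` times a projection matrix, so a column of `u` of weight `w k` has norm at most
`10 + w k ^ 2`. On the other hand its sum is `10 * w k`. This leaves the weights `0` and `1`. Columns
of weight `1` are indicator functions of Petersen sets, and there are ten of them. Nonzero columns of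
weight `0` are eigenvectors for the eigenvalue `2`, and have norm exactly `10`
(`IsSRGWith.ten_le_sum_sq`), hence are orthogonal to all other columns. The key identity then
restricts to the ten Petersen sets, and shows that they form a grid
(`IsIntegralFrame.exists_grid`): two partitions of the vertex set into five Petersen sets, such that
sets from different partitions meet in exactly two vertices.

Such a grid does not exist (`IsSRGWith.not_isPetersenGrid`). Since triangles and quadrangles are
excluded, each of the 25 cells is an edge, and any two cells of the same row or the same column are
joined by exactly one edge. Two rows are joined by a perfect matching, half of which stays within the
columns, while the other half defines a permutation of the columns, which turns out to be a `5`-cycle.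
The possible positions of the edges within the two rows can then be enumerated
(`not_isCompatible`), and each of them produces a triangle or a quadrangle.
-/

/-! ### Robertson's graph -/

theorem hoffmanSingleton_isSRGWith : hoffmanSingleton.IsSRGWith 50 7 0 1 where
  card := by simp [ZMod.card]
  regular := by
    unfold SimpleGraph.IsRegularOfDegree
    decide +kernel
  of_adj := by decide +kernel
  of_not_adj := by unfold Pairwise; decide +kernel

/-! ### Eigenvalues and common neighbours -/

namespace SimpleGraph

section Basic

variable {V : Type*} [Fintype V] {G : SimpleGraph V} [DecidableRel G.Adj]

theorem IsSRGWith.sum_adjMatrix_apply {R : Type*} [Ring R] (h : G.IsSRGWith 50 7 0 1) (x : V) :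
    ∑ y, G.adjMatrix R x y = 7 := by
  have := h.regular x
  rw [← card_neighborFinset_eq_degree] at this
  simp only [adjMatrix_apply, Finset.sum_boole]
  rw [← neighborFinset_eq_filter, this]
  norm_num

theorem IsSRGWith.sum_adjMatrix_apply' {R : Type*} [Ring R] (h : G.IsSRGWith 50 7 0 1) (x : V) :
    ∑ y, G.adjMatrix R y x = 7 := by
  rw [← h.sum_adjMatrix_apply (R := R) x]
  refine Finset.sum_congr rfl fun y _ => ?_
  simp [adjMatrix_apply, G.adj_comm]

theorem IsSRGWith.not_adj_of_adj_of_adj (h : G.IsSRGWith 50 7 0 1) {x y z : V}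
    (hxy : G.Adj x y) (hyz : G.Adj y z) : ¬ G.Adj x z := fun hxz => by
  have := h.of_adj x z hxz
  rw [Fintype.card_eq_zero_iff] at this
  exact this.elim ⟨y, hxy, hyz.symm⟩

/-- Distinct vertices have at most one common neighbour. -/
theorem IsSRGWith.eq_of_common_neighbor (h : G.IsSRGWith 50 7 0 1) {x y z t : V} (hxz : x ≠ z)
    (hxy : G.Adj x y) (hyz : G.Adj y z) (hxt : G.Adj x t) (htz : G.Adj t z) : y = t := by
  have := h.of_not_adj hxz (h.not_adj_of_adj_of_adj hxy hyz)
  have := Fintype.card_le_one_iff.1 this.le ⟨y, hxy, hyz.symm⟩ ⟨t, hxt, htz.symm⟩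
  exact congrArg Subtype.val this

theorem IsSRGWith.exists_common_neighbor (h : G.IsSRGWith 50 7 0 1) {x z : V} (hxz : x ≠ z)
    (hn : ¬ G.Adj x z) : ∃ y, G.Adj x y ∧ G.Adj y z := by
  have := h.of_not_adj hxz hn
  obtain ⟨y, hy⟩ := Fintype.card_pos_iff.1 (this.symm ▸ one_pos)
  exact ⟨y, hy.1, hy.2.symm⟩

end Basic

section Spectrum

variable {V : Type*} [Fintype V] [DecidableEq V] {G : SimpleGraph V} [DecidableRel G.Adj]

theorem IsSRGWith.adjMatrix_mul_self_apply {R : Type*} [Ring R] (h : G.IsSRGWith 50 7 0 1)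
    (x z : V) :
    ∑ y, G.adjMatrix R x y * G.adjMatrix R y z =
      6 * (if x = z then 1 else 0) - G.adjMatrix R x z + 1 := by
  have h1 := congrFun (congrFun (h.matrix_eq (α := R)) x) z
  rw [sq, Matrix.mul_apply] at h1
  rw [h1]
  simp only [Matrix.add_apply, Matrix.smul_apply, Matrix.one_apply, adjMatrix_apply, compl_adj]
  by_cases hxz : x = z
  · subst hxz
    simp
    norm_num
  · by_cases ha : G.Adj x z <;> simp [hxz, ha]

/-- The columns of `(A - 2)(A - 7)` are eigenvectors for `-3`. An eigenvector for `θ ≠ 7` has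
coordinate sum `0`, hence `(θ ^ 2 + θ - 6) v = 0`, which excludes `θ < -3`. -/
theorem IsSRGWith.isLeast_graphEigenvalues (h : G.IsSRGWith 50 7 0 1) :
    IsLeast G.graphEigenvalues (-3) := by
  constructor
  · have hV : Nonempty V := Fintype.card_pos_iff.1 (by rw [h.card]; norm_num)
    obtain ⟨z⟩ := hV
    refine Module.End.hasEigenvalue_of_hasEigenvector
      (x := fun y => 20 * (if y = z then 1 else 0) - 10 * G.adjMatrix ℝ y z + 1) ?_
    rw [Module.End.hasEigenvector_iff, Module.End.mem_eigenspace_iff]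
    constructor
    · ext x
      have h1 := h.adjMatrix_mul_self_apply (R := ℝ) x z
      have h2 := h.sum_adjMatrix_apply (R := ℝ) x
      have h3 : ∑ y, G.adjMatrix ℝ x y * (if y = z then 1 else 0) = G.adjMatrix ℝ x z := by simp
      simp only [Matrix.toLin'_apply, Matrix.mulVec, dotProduct, Pi.smul_apply, smul_eq_mul]
      calc ∑ y, G.adjMatrix ℝ x y *
            (20 * (if y = z then 1 else 0) - 10 * G.adjMatrix ℝ y z + 1)
          = 20 * ∑ y, G.adjMatrix ℝ x y * (if y = z then 1 else 0)
            - 10 * ∑ y, G.adjMatrix ℝ x y * G.adjMatrix ℝ y z + ∑ y, G.adjMatrix ℝ x y := by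
            simp only [Finset.mul_sum, ← Finset.sum_sub_distrib, ← Finset.sum_add_distrib]
            exact Finset.sum_congr rfl fun y _ => by ring
        _ = _ := by rw [h1, h2, h3]; ring
    · intro h0
      have := congrFun h0 z
      simp at this
      norm_num at this
  · intro θ hθ
    obtain ⟨v, hv⟩ := Module.End.HasEigenvalue.exists_hasEigenvector hθ
    rw [Module.End.hasEigenvector_iff, Module.End.mem_eigenspace_iff] at hv
    obtain ⟨hv, hv0⟩ := hv
    have e1 : ∀ x, ∑ y, G.adjMatrix ℝ x y * v y = θ * v x := fun x => by
      have := congrFun hv x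
      simpa only [Matrix.toLin'_apply, Matrix.mulVec, dotProduct, Pi.smul_apply,
        smul_eq_mul] using this
    by_contra! hlt
    have hs : ∑ x, v x = 0 := by
      have : 7 * ∑ y, v y = θ * ∑ x, v x := by
        rw [Finset.mul_sum, Finset.mul_sum, ← Finset.sum_congr rfl fun x _ => e1 x,
          Finset.sum_comm]
        refine Finset.sum_congr rfl fun y _ => ?_
        rw [← Finset.sum_mul, h.sum_adjMatrix_apply']
      have h7 : (7 - θ) * ∑ x, v x = 0 := by linarith
      exact (mul_eq_zero.1 h7).resolve_left (by linarith)
    apply hv0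
    ext x
    have e2 : ∑ z, (∑ y, G.adjMatrix ℝ x y * G.adjMatrix ℝ y z) * v z = θ * (θ * v x) := by
      simp only [Finset.sum_mul, mul_assoc]
      rw [Finset.sum_comm, ← e1 x, Finset.mul_sum]
      refine Finset.sum_congr rfl fun y _ => ?_
      rw [← Finset.mul_sum, e1]
      ring
    have e3 : ∑ z, (∑ y, G.adjMatrix ℝ x y * G.adjMatrix ℝ y z) * v z
        = 6 * v x - θ * v x + ∑ z, v z := by
      rw [← e1 x]
      calc _ = ∑ z, (6 * ((if x = z then 1 else 0) * v z) - G.adjMatrix ℝ x z * v z + v z) :=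
            Finset.sum_congr rfl fun z _ => by rw [h.adjMatrix_mul_self_apply]; ring
        _ = _ := by
            simp only [Finset.sum_add_distrib, Finset.sum_sub_distrib, ← Finset.mul_sum]
            simp
    have e4 : ((θ + 3) * (θ - 2)) * v x = 0 := by linarith
    exact (mul_eq_zero.1 e4).resolve_left (mul_pos_of_neg_of_neg (by linarith) (by linarith)).ne'

end Spectrum

/-- If the graph is `2`-integrable, then there are integer vectors with Gram matrix
`2 (A + 3)`. -/
theorem IsSRGWith.exists_int_vectors {V : Type*} [Fintype V] [DecidableEq V] {G : SimpleGraph V}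
    [DecidableRel G.Adj] (h : G.IsSRGWith 50 7 0 1) (hi : G.IsIntegrable 2) :
    ∃ (m : ℕ) (u : V → Fin m → ℤ), ∀ x y,
      u x ⬝ᵥ u y = 2 * (3 * (if x = y then 1 else 0) + G.adjMatrix ℤ x y) := by
  obtain ⟨n, φ, hφ, m, f, hf⟩ := hi
  have ht : (-(⌊G.minEigenvalue⌋ : ℝ)) = 3 := by
    rw [minEigenvalue, h.isLeast_graphEigenvalues.csInf_eq]
    have : ⌊(-3 : ℝ)⌋ = -3 := by
      rw [Int.floor_eq_iff]; norm_num
    rw [this]; norm_num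
  rw [ht] at hφ
  have hmem : ∀ x, Real.sqrt ((2 : ℕ) : ℝ) • φ x ∈
      Real.sqrt ((2 : ℕ) : ℝ) • Submodule.span ℤ (Set.range φ) := fun x =>
    Submodule.smul_mem_pointwise_smul _ _ _ (Submodule.subset_span ⟨x, rfl⟩)
  refine ⟨m, fun x => f ⟨_, hmem x⟩, fun x y => ?_⟩
  have h1 := hf ⟨_, hmem x⟩ ⟨_, hmem y⟩
  simp only [inner_smul_left, inner_smul_right] at h1
  have h2 : Real.sqrt 2 * Real.sqrt 2 = 2 := Real.mul_self_sqrt (by norm_num)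
  have h3 : inner ℝ (φ x) (φ y) = 3 * (if x = y then 1 else 0) + G.adjMatrix ℝ x y := by
    by_cases hxy : x = y
    · subst hxy
      rw [hφ.inner_self x]
      simp
    · by_cases ha : G.Adj x y
      · simp [hφ.inner_adj x y ha, hxy, ha]
      · simp [hφ.inner_not_adj x y hxy ha, hxy, ha]
  rw [h3] at h1
  have h4 : (((f ⟨_, hmem x⟩ ⬝ᵥ f ⟨_, hmem y⟩ : ℤ)) : ℝ) =
      ((2 * (3 * (if x = y then 1 else 0) + G.adjMatrix ℤ x y) : ℤ) : ℝ) := by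
    rw [h1]
    simp only [RCLike.conj_to_real, Nat.cast_ofNat, ← mul_assoc, h2, adjMatrix_apply]
    push_cast
    rfl
  exact_mod_cast h4

end SimpleGraph

/-! ### Integer vectors with Gram matrix `2 (A + 3)` -/

namespace SimpleGraph

/-- The inner product of two columns of `u`. -/
def colGram {V : Type*} [Fintype V] {m : ℕ} (u : V → Fin m → ℤ) (k l : Fin m) : ℤ := ∑ x, u x k * u x l

theorem colGram_comm {V : Type*} [Fintype V] {m : ℕ} (u : V → Fin m → ℤ)
    (k l : Fin m) : colGram u k l = colGram u l k :=
  Finset.sum_congr rfl fun _ _ => mul_comm _ _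

/-- Integer vectors `u x` indexed by the vertices, with Gram matrix `2 (A + 3)`, together with the
vector `w` for which `∑ y ∼ x, u y = 2 u x + w` for all `x`. The signs of the coordinates are
normalized so that `w` is nonnegative. -/
structure IsIntegralFrame {V : Type*} [Fintype V] [DecidableEq V] (G : SimpleGraph V)
    [DecidableRel G.Adj] {m : ℕ} (u : V → Fin m → ℤ) (w : Fin m → ℤ) : Prop where
  gram : ∀ x y, ∑ k, u x k * u y k = 2 * (3 * (if x = y then 1 else 0) + G.adjMatrix ℤ x y)
  neighbor_sum : ∀ x k, ∑ y, G.adjMatrix ℤ x y * u y k = 2 * u x k + w k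
  nonneg : ∀ k, 0 ≤ w k

variable {V : Type*} [Fintype V] [DecidableEq V] {G : SimpleGraph V} [DecidableRel G.Adj]
  {m : ℕ} {u : V → Fin m → ℤ} {w : Fin m → ℤ}

/-- Since `(A + 3) (A - 2)` is the all-ones matrix, the vectors `∑ y ∼ x, u y - 2 u x` all have
the same inner products with the `u z`; they are integer combinations of the `u z`, so they are
all equal. -/
theorem IsSRGWith.exists_isIntegralFrame (h : G.IsSRGWith 50 7 0 1)
    (hu : ∀ x y, u x ⬝ᵥ u y = 2 * (3 * (if x = y then 1 else 0) + G.adjMatrix ℤ x y)) :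
    ∃ (u' : V → Fin m → ℤ) (w : Fin m → ℤ), G.IsIntegralFrame u' w := by
  have hV : Nonempty V := Fintype.card_pos_iff.1 (by rw [h.card]; norm_num)
  obtain ⟨o⟩ := hV
  have gram : ∀ x y, ∑ k, u x k * u y k =
      2 * (3 * (if x = y then 1 else 0) + G.adjMatrix ℤ x y) := hu
  obtain ⟨d, hd⟩ : ∃ d : V → Fin m → ℤ, ∀ x k,
      d x k = ∑ y, G.adjMatrix ℤ x y * u y k - 2 * u x k := ⟨_, fun _ _ => rfl⟩
  have d_inner : ∀ x z, ∑ k, d x k * u z k = 2 := fun x z => by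
    have e1 := h.adjMatrix_mul_self_apply (R := ℤ) x z
    calc ∑ k, d x k * u z k
        = ∑ y, G.adjMatrix ℤ x y * ∑ k, u y k * u z k - 2 * ∑ k, u x k * u z k := by
          simp only [hd, sub_mul, Finset.sum_sub_distrib, Finset.sum_mul, Finset.mul_sum]
          rw [Finset.sum_comm]
          simp only [mul_assoc]
      _ = 6 * ∑ y, G.adjMatrix ℤ x y * (if y = z then 1 else 0)
          + 2 * ∑ y, G.adjMatrix ℤ x y * G.adjMatrix ℤ y z - 2 * ∑ k, u x k * u z k := by
          congr 1
          rw [Finset.mul_sum, Finset.mul_sum, ← Finset.sum_add_distrib]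
          refine Finset.sum_congr rfl fun y _ => ?_
          rw [gram]
          ring
      _ = 2 := by
          rw [e1, gram]
          simp only [mul_ite, mul_one, mul_zero, Finset.sum_ite_eq', Finset.mem_univ, if_true]
          split_ifs <;> ring
  have d_comb : ∀ x (v : Fin m → ℤ), (∀ z, ∑ k, v k * u z k = 0) → ∑ k, v k * d x k = 0 :=
    fun x v hv => by
      calc ∑ k, v k * d x k
          = ∑ y, G.adjMatrix ℤ x y * ∑ k, v k * u y k - 2 * ∑ k, v k * u x k := by
            simp only [hd, mul_sub, Finset.sum_sub_distrib, Finset.mul_sum]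
            rw [Finset.sum_comm]
            congr 1
            · exact Finset.sum_congr rfl fun y _ => Finset.sum_congr rfl fun k _ => by ring
            · exact Finset.sum_congr rfl fun k _ => by ring
        _ = 0 := by simp [hv]
  have d_eq : ∀ x k, d x k = d o k := fun x => by
    have h0 : ∀ z, ∑ k, (d x k - d o k) * u z k = 0 := fun z => by
      simp only [sub_mul, Finset.sum_sub_distrib, d_inner, sub_self]
    have h1 : ∑ k, (d x k - d o k) ^ 2 = 0 := by
      have e1 := d_comb x _ h0
      have e2 := d_comb o _ h0
      calc ∑ k, (d x k - d o k) ^ 2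
          = ∑ k, (d x k - d o k) * d x k - ∑ k, (d x k - d o k) * d o k := by
            rw [← Finset.sum_sub_distrib]
            exact Finset.sum_congr rfl fun k _ => by ring
        _ = 0 := by rw [e1, e2, sub_zero]
    intro k
    have := (Finset.sum_eq_zero_iff_of_nonneg fun k _ => sq_nonneg (d x k - d o k)).1 h1 k
      (Finset.mem_univ k)
    exact sub_eq_zero.1 (pow_eq_zero_iff two_ne_zero |>.1 this)
  obtain ⟨ε, hε⟩ : ∃ ε : Fin m → ℤ, ∀ k, ε k * ε k = 1 ∧ 0 ≤ ε k * d o k := by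
    refine ⟨fun k => if 0 ≤ d o k then 1 else -1, fun k => ?_⟩
    by_cases hk : 0 ≤ d o k <;> simp [hk]
    omega
  refine ⟨fun x k => ε k * u x k, fun k => ε k * d o k, ⟨fun x y => ?_, fun x k => ?_, fun k =>
    (hε k).2⟩⟩
  · rw [← gram]
    refine Finset.sum_congr rfl fun k _ => ?_
    linear_combination (u x k * u y k) * (hε k).1
  · rw [← d_eq x k, hd]
    have : ∑ y, G.adjMatrix ℤ x y * (ε k * u y k) = ε k * ∑ y, G.adjMatrix ℤ x y * u y k := by
      rw [Finset.mul_sum]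
      exact Finset.sum_congr rfl fun y _ => by ring
    rw [this]
    ring

namespace IsIntegralFrame

theorem sum_apply (hf : G.IsIntegralFrame u w) (h : G.IsSRGWith 50 7 0 1) (k : Fin m) :
    ∑ x, u x k = 10 * w k := by
  have e1 : 7 * ∑ y, u y k = ∑ x, (2 * u x k + w k) := by
    simp only [← hf.neighbor_sum]
    rw [Finset.sum_comm, Finset.mul_sum]
    exact Finset.sum_congr rfl fun y _ => by rw [← Finset.sum_mul, h.sum_adjMatrix_apply']
  rw [Finset.sum_add_distrib, ← Finset.mul_sum, Finset.sum_const, Finset.card_univ, h.card] at e1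
  simp only [nsmul_eq_mul] at e1
  push_cast at e1
  linarith

theorem inner_weight (hf : G.IsIntegralFrame u w) (h : G.IsSRGWith 50 7 0 1) (z : V) :
    ∑ k, w k * u z k = 2 := by
  have e1 : ∑ k, 10 * (w k * u z k) = ∑ x, ∑ k, u x k * u z k := by
    rw [Finset.sum_comm]
    refine Finset.sum_congr rfl fun k _ => ?_
    rw [← Finset.sum_mul, hf.sum_apply h]
    ring
  have e2 : ∑ x, ∑ k, u x k * u z k = 20 := by
    simp only [hf.gram, ← Finset.mul_sum, Finset.sum_add_distrib, h.sum_adjMatrix_apply']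
    simp
  rw [e2, ← Finset.mul_sum] at e1
  linarith

theorem sum_weight_sq (hf : G.IsIntegralFrame u w) (h : G.IsSRGWith 50 7 0 1) :
    ∑ k, w k * w k = 10 := by
  have e1 : ∑ k, 10 * (w k * w k) = ∑ x, ∑ k, w k * u x k := by
    rw [Finset.sum_comm]
    refine Finset.sum_congr rfl fun k _ => ?_
    rw [← Finset.mul_sum, hf.sum_apply h]
    ring
  simp only [hf.inner_weight h, Finset.sum_const, Finset.card_univ, h.card,
    ← Finset.mul_sum] at e1
  simp only [nsmul_eq_mul] at e1
  push_cast at e1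
  linarith

end IsIntegralFrame

namespace IsIntegralFrame

theorem sum_colGram_mul_weight (hf : G.IsIntegralFrame u w) (h : G.IsSRGWith 50 7 0 1)
    (k : Fin m) : ∑ j, colGram u k j * w j = 20 * w k := by
  have : ∑ j, colGram u k j * w j = ∑ x, u x k * ∑ j, w j * u x j := by
    simp only [colGram, Finset.sum_mul, Finset.mul_sum]
    rw [Finset.sum_comm]
    exact Finset.sum_congr rfl fun x _ => Finset.sum_congr rfl fun j _ => by ring
  rw [this]
  simp only [hf.inner_weight h, ← Finset.sum_mul, hf.sum_apply h]
  ring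

theorem sum_colGram_mul_colGram (hf : G.IsIntegralFrame u w) (h : G.IsSRGWith 50 7 0 1)
    (k l : Fin m) :
    ∑ j, colGram u k j * colGram u j l = 10 * colGram u k l + 20 * (w k * w l) := by
  calc ∑ j, colGram u k j * colGram u j l
      = ∑ x, ∑ y, u x k * (∑ j, u x j * u y j) * u y l := by
        simp only [colGram, Finset.sum_mul, Finset.mul_sum]
        rw [Finset.sum_comm]
        rw [Finset.sum_congr rfl fun y _ => Finset.sum_comm]
        rw [Finset.sum_comm]
        exact Finset.sum_congr rfl fun x _ => Finset.sum_congr rfl fun y _ =>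
          Finset.sum_congr rfl fun j _ => by ring
    _ = ∑ x, u x k * (6 * u x l + 2 * ∑ y, G.adjMatrix ℤ x y * u y l) := by
        refine Finset.sum_congr rfl fun x _ => ?_
        have : 6 * u x l = ∑ y, 6 * ((if x = y then 1 else 0) * u y l) := by simp
        rw [this, Finset.mul_sum, ← Finset.sum_add_distrib, Finset.mul_sum]
        exact Finset.sum_congr rfl fun y _ => by rw [hf.gram]; ring
    _ = ∑ x, (10 * (u x k * u x l) + 2 * w l * u x k) :=
        Finset.sum_congr rfl fun x _ => by rw [hf.neighbor_sum]; ring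
    _ = _ := by
        rw [Finset.sum_add_distrib, ← Finset.mul_sum, ← Finset.mul_sum, hf.sum_apply h, colGram]
        ring

/-- The matrix `∑ x, u x k * u x l - w k * w l` is `10` times an orthogonal projection. -/
theorem sum_mul_self (hf : G.IsIntegralFrame u w) (h : G.IsSRGWith 50 7 0 1) (k l : Fin m) :
    ∑ j, (colGram u k j - w k * w j) * (colGram u l j - w l * w j) =
      10 * (colGram u k l - w k * w l) := by
  calc _ = ∑ j, colGram u k j * colGram u j l - w l * ∑ j, colGram u k j * w j
          - w k * ∑ j, colGram u l j * w j + w k * w l * ∑ j, w j * w j := by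
        simp only [Finset.mul_sum, ← Finset.sum_sub_distrib, ← Finset.sum_add_distrib]
        exact Finset.sum_congr rfl fun j _ => by rw [colGram_comm u j l]; ring
    _ = _ := by
        rw [hf.sum_colGram_mul_colGram h, hf.sum_colGram_mul_weight h,
          hf.sum_colGram_mul_weight h, hf.sum_weight_sq h]
        ring

theorem colGram_self_le (hf : G.IsIntegralFrame u w) (h : G.IsSRGWith 50 7 0 1) (k : Fin m) :
    colGram u k k ≤ 10 + w k * w k := by
  have e := hf.sum_mul_self h k k
  have : (colGram u k k - w k * w k) * (colGram u k k - w k * w k) ≤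
      ∑ j, (colGram u k j - w k * w j) * (colGram u k j - w k * w j) :=
    Finset.single_le_sum (f := fun j => (colGram u k j - w k * w j) * (colGram u k j - w k * w j))
      (fun j _ => mul_self_nonneg _) (Finset.mem_univ k)
  nlinarith

theorem weight_le_one (hf : G.IsIntegralFrame u w) (h : G.IsSRGWith 50 7 0 1) (k : Fin m) :
    w k ≤ 1 := by
  have h1 : w k * w k ≤ 10 := by
    rw [← hf.sum_weight_sq h]
    exact Finset.single_le_sum (f := fun j => w j * w j) (fun j _ => mul_self_nonneg _)
      (Finset.mem_univ k)
  have h2 : 10 * w k ≤ colGram u k k := by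
    rw [← hf.sum_apply h]
    exact Finset.sum_le_sum fun x _ => by
      rcases le_or_gt (u x k) 0 with h0 | h0 <;> nlinarith [mul_self_nonneg (u x k)]
  have h3 := hf.colGram_self_le h k
  have h4 : w k ≤ 3 := by nlinarith
  have h5 := hf.nonneg k
  generalize w k = a at *
  interval_cases a <;> omega

theorem eq_zero_or_one (hf : G.IsIntegralFrame u w) (h : G.IsSRGWith 50 7 0 1) {k : Fin m}
    (hk : w k = 1) (x : V) : u x k = 0 ∨ u x k = 1 := by
  have h0 : ∀ a : ℤ, 0 ≤ a * a - a := fun a => by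
    rcases le_or_gt a 0 with h0 | h0 <;> nlinarith [mul_self_nonneg a]
  have h1 : ∑ x, (u x k * u x k - u x k) ≤ 1 := by
    rw [Finset.sum_sub_distrib, hf.sum_apply h, hk]
    have := hf.colGram_self_le h k
    rw [hk, colGram] at this
    linarith
  have h2 : u x k * u x k - u x k ≤ 1 := (Finset.single_le_sum (f := fun x => u x k * u x k - u x k) (fun x _ => h0 _)
    (Finset.mem_univ x)).trans h1
  have h3 : u x k < 2 := by
    by_contra! hc
    nlinarith
  have h4 : -1 < u x k := by
    by_contra! hc
    nlinarith
  omega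

theorem colGram_self_of_weight_one (hf : G.IsIntegralFrame u w) (h : G.IsSRGWith 50 7 0 1)
    {k : Fin m} (hk : w k = 1) : colGram u k k = 10 := by
  have : colGram u k k = ∑ x, u x k := Finset.sum_congr rfl fun x _ => by
    rcases hf.eq_zero_or_one h hk x with e | e <;> rw [e] <;> rfl
  rw [this, hf.sum_apply h, hk, mul_one]

end IsIntegralFrame

end SimpleGraph

/-! ### Columns of weight zero and one -/

namespace SimpleGraph

/-- A nonzero integer eigenvector `z` for the eigenvalue `2` has norm at least `10`. Its positive
part has sum at least `5`: if the maximum `a` of `z` is at least `2`, a vertex where it is attained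
and its neighbours contribute `3 a`; if `a = 1`, the vertices with value `1` induce a subgraph of
minimum degree at least `2`, so there are at least five of them, as there are no triangles and no
quadrangles. -/
theorem IsSRGWith.ten_le_sum_sq {V : Type*} [Fintype V] {G : SimpleGraph V}
    [DecidableRel G.Adj] (h : G.IsSRGWith 50 7 0 1) {z : V → ℤ}
    (hz : ∀ x, ∑ y, G.adjMatrix ℤ x y * z y = 2 * z x) (hs : ∑ x, z x = 0) (hne : ∃ x, z x ≠ 0) :
    10 ≤ ∑ x, z x * z x := by
  classical
  have hpos : ∃ x, 0 < z x := by
    by_contra! hc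
    obtain ⟨x, hx⟩ := hne
    exact hx ((Finset.sum_eq_zero_iff_of_nonpos fun x _ => hc x).1 hs x (Finset.mem_univ x))
  obtain ⟨x₁, hx₁⟩ := hpos
  obtain ⟨x, -, hmax⟩ := Finset.exists_max_image Finset.univ z ⟨x₁, Finset.mem_univ _⟩
  have hmax : ∀ y, z y ≤ z x := fun y => hmax y (Finset.mem_univ y)
  have hx : 0 < z x := hx₁.trans_le (hmax x₁)
  have hz' : ∀ v, ∑ y ∈ G.neighborFinset v, z y = 2 * z v := fun v => by
    rw [← hz v, neighborFinset_eq_filter, Finset.sum_filter]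
    exact Finset.sum_congr rfl fun y _ => by simp [adjMatrix_apply]
  suffices hp : 5 ≤ ∑ y, max (z y) 0 by
    have h1 : ∀ a : ℤ, 2 * max a 0 - a ≤ a * a := fun a => by
      rcases le_total a 0 with h0 | h0
      · rw [max_eq_right h0]
        rcases h0.lt_or_eq with h0 | h0 <;> nlinarith
      · rw [max_eq_left h0]
        rcases h0.lt_or_eq with h0 | h0 <;> nlinarith
    have h2 := Finset.sum_le_sum fun y (_ : y ∈ Finset.univ) => h1 (z y)
    rw [Finset.sum_sub_distrib, ← Finset.mul_sum, hs] at h2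
    linarith
  have key : ∀ s : Finset V, ∑ y ∈ s, z y ≤ ∑ y, max (z y) 0 := fun s =>
    (Finset.sum_le_sum fun y _ => le_max_left _ _).trans
      (Finset.sum_le_sum_of_subset_of_nonneg (Finset.subset_univ s) fun y _ _ => le_max_right _ _)
  rcases (show z x = 1 ∨ 2 ≤ z x by omega) with h1 | h2
  · have hnext : ∀ v a, z v = 1 → ∃ y, G.Adj v y ∧ y ≠ a ∧ z y = 1 := fun v a hv => by
      by_contra! hc
      have hle : ∑ y ∈ G.neighborFinset v, z y ≤
          ∑ y ∈ G.neighborFinset v, if y = a then 1 else 0 := by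
        refine Finset.sum_le_sum fun y hy => ?_
        split_ifs with e
        · exact (hmax y).trans_eq h1
        · have := hc y ((mem_neighborFinset _ _ _).1 hy) e
          have := hmax y
          omega
      rw [hz', hv, Finset.sum_ite_eq'] at hle
      split_ifs at hle <;> omega
    obtain ⟨y₁, hxy₁, -, e₁⟩ := hnext x x h1
    obtain ⟨y₂, hxy₂, hne₂, e₂⟩ := hnext x y₁ h1
    obtain ⟨y₃, hy₃, hne₃, e₃⟩ := hnext y₁ x e₁
    obtain ⟨y₄, hy₄, hne₄, e₄⟩ := hnext y₂ x e₂
    have n12 : ¬ G.Adj y₁ y₂ := h.not_adj_of_adj_of_adj hxy₁.symm hxy₂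
    have n32 : y₃ ≠ y₂ := fun e => n12 (e ▸ hy₃)
    have n41 : y₄ ≠ y₁ := fun e => n12 (e ▸ hy₄.symm)
    have n34 : y₃ ≠ y₄ := fun e =>
      hne₃ (h.eq_of_common_neighbor hne₂.symm hy₃ (e ▸ hy₄.symm) hxy₁.symm hxy₂)
    have hsum := key {x, y₁, y₂, y₃, y₄}
    rw [Finset.sum_insert, Finset.sum_insert, Finset.sum_insert, Finset.sum_insert,
      Finset.sum_singleton, h1, e₁, e₂, e₃, e₄] at hsum
    · exact hsum
    · simpa using n34
    · simp [n32.symm, hy₄.ne]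
    · simp [hne₂.symm, hy₃.ne, n41.symm]
    · simp [hxy₁.ne, hxy₂.ne, hne₃.symm, hne₄.symm]
  · have hsum := key (insert x (G.neighborFinset x))
    rw [Finset.sum_insert (by simp), hz'] at hsum
    linarith

/-- A set of ten vertices in which every vertex has three neighbours, such that every other
vertex has exactly one neighbour in it. In a graph without triangles and quadrangles it induces a
Petersen graph. -/
structure IsPetersenSet {V : Type*} (G : SimpleGraph V) [DecidableRel G.Adj] (S : Finset V) :
    Prop where
  card_eq : S.card = 10
  inside : ∀ x ∈ S, (S.filter (G.Adj x)).card = 3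
  outside : ∀ x ∉ S, (S.filter (G.Adj x)).card = 1

variable {V : Type*} [Fintype V] [DecidableEq V] {G : SimpleGraph V} [DecidableRel G.Adj]
  {m : ℕ} {u : V → Fin m → ℤ} {w : Fin m → ℤ}

/-- The set of vertices for which the `k`-th coordinate of `u` is `1`. -/
def colSupport {V : Type*} [Fintype V] {m : ℕ} (u : V → Fin m → ℤ) (k : Fin m) : Finset V :=
  Finset.univ.filter fun x => u x k = 1

namespace IsIntegralFrame

theorem isPetersenSet (hf : G.IsIntegralFrame u w) (h : G.IsSRGWith 50 7 0 1) {k : Fin m}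
    (hk : w k = 1) : G.IsPetersenSet (colSupport u k) := by
  have h01 := hf.eq_zero_or_one h hk
  have e1 : ∀ x, u x k = if u x k = 1 then 1 else 0 := fun x => by
    rcases h01 x with e | e <;> simp [e]
  have e2 : ∀ x, (((colSupport u k).filter (G.Adj x)).card : ℤ) = 2 * u x k + 1 := fun x => by
    rw [← hk, ← hf.neighbor_sum, colSupport, Finset.filter_filter, ← Finset.sum_boole]
    refine Finset.sum_congr rfl fun y _ => ?_
    rw [e1 y, adjMatrix_apply]
    by_cases a : G.Adj x y <;> by_cases b : u y k = 1 <;> simp [a, b]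
  refine ⟨?_, fun x hx => ?_, fun x hx => ?_⟩
  · have : ((colSupport u k).card : ℤ) = 10 := by
      rw [colSupport, ← Finset.sum_boole, ← Finset.sum_congr rfl fun x _ => e1 x,
        hf.sum_apply h, hk, mul_one]
    exact_mod_cast this
  · have := e2 x
    rw [(Finset.mem_filter.1 hx).2] at this
    omega
  · have := e2 x
    have h0 : u x k = 0 := (h01 x).resolve_right fun e =>
      hx (Finset.mem_filter.2 ⟨Finset.mem_univ x, e⟩)
    rw [h0] at this
    omega

theorem card_colSupport_inter (hf : G.IsIntegralFrame u w) (h : G.IsSRGWith 50 7 0 1)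
    {k l : Fin m} (hk : w k = 1) (hl : w l = 1) :
    ((colSupport u k ∩ colSupport u l).card : ℤ) = colGram u k l := by
  rw [colSupport, colSupport, ← Finset.filter_and, ← Finset.sum_boole, colGram]
  refine Finset.sum_congr rfl fun x _ => ?_
  rcases hf.eq_zero_or_one h hk x with e | e <;>
    rcases hf.eq_zero_or_one h hl x with e' | e' <;> simp [e, e']

theorem weight_eq_zero_or_one (hf : G.IsIntegralFrame u w) (h : G.IsSRGWith 50 7 0 1)
    (k : Fin m) : w k = 0 ∨ w k = 1 := by
  have := hf.nonneg k
  have := hf.weight_le_one h k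
  omega

theorem card_weight_one (hf : G.IsIntegralFrame u w) (h : G.IsSRGWith 50 7 0 1) :
    (Finset.univ.filter fun k => w k = 1).card = 10 := by
  have : ((Finset.univ.filter fun k => w k = 1).card : ℤ) = 10 := by
    rw [← Finset.sum_boole, ← hf.sum_weight_sq h]
    refine Finset.sum_congr rfl fun k _ => ?_
    rcases hf.weight_eq_zero_or_one h k with e | e <;> simp [e]
  exact_mod_cast this

/-- A nonzero column of weight `0` has norm exactly `10`, so its diagonal entry exhausts its row
of the matrix in `sum_mul_self`. -/
theorem colGram_eq_zero (hf : G.IsIntegralFrame u w) (h : G.IsSRGWith 50 7 0 1) {k l : Fin m}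
    (hl : w l = 0) (hkl : k ≠ l) : colGram u k l = 0 := by
  by_cases hne : ∃ x, u x l ≠ 0
  · have h1 : 10 ≤ colGram u l l := by
      refine h.ten_le_sum_sq (z := fun x => u x l) (fun x => ?_) ?_ hne
      · rw [hf.neighbor_sum, hl, add_zero]
      · rw [hf.sum_apply h, hl, mul_zero]
    have h2 := hf.colGram_self_le h l
    have h3 := hf.sum_mul_self h l l
    simp only [hl, zero_mul, sub_zero, add_zero] at h2 h3
    have h4 : colGram u l l = 10 := le_antisymm h2 h1
    have h5 : ∑ j ∈ {l, k}, colGram u l j * colGram u l j ≤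
        ∑ j, colGram u l j * colGram u l j :=
      Finset.sum_le_sum_of_subset_of_nonneg (Finset.subset_univ _) fun j _ _ => mul_self_nonneg _
    rw [Finset.sum_pair hkl.symm, h3, h4] at h5
    rw [colGram_comm]
    nlinarith
  · push Not at hne
    exact Finset.sum_eq_zero fun x _ => by rw [hne x, mul_zero]

end IsIntegralFrame

end SimpleGraph

/-! ### The grid of Petersen sets -/

namespace SimpleGraph

/-- For coordinates `k`, `l` of weight `1`, the sign that records whether the Petersen sets
`colSupport u k` and `colSupport u l` are equal or disjoint (`1`), or meet in two points (`-1`). -/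
def colSign {V : Type*} [Fintype V] {m : ℕ} (u : V → Fin m → ℤ) (k l : Fin m) : ℤ :=
  (if k = l then 10 else 0) + 1 - colGram u k l

theorem colSign_comm {V : Type*} [Fintype V] {m : ℕ} (u : V → Fin m → ℤ) (k l : Fin m) :
    colSign u k l = colSign u l k := by
  simp only [colSign, colGram_comm u k l, eq_comm (a := k) (b := l)]

variable {V : Type*} [Fintype V] [DecidableEq V] {G : SimpleGraph V} [DecidableRel G.Adj]
  {m : ℕ} {u : V → Fin m → ℤ} {w : Fin m → ℤ}

namespace IsIntegralFrame

theorem colSign_self (hf : G.IsIntegralFrame u w) (h : G.IsSRGWith 50 7 0 1) {k : Fin m}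
    (hk : w k = 1) : colSign u k k = 1 := by
  rw [colSign, hf.colGram_self_of_weight_one h hk, if_pos rfl]
  norm_num

theorem sum_colSign (hf : G.IsIntegralFrame u w) (h : G.IsSRGWith 50 7 0 1) {k : Fin m}
    (hk : w k = 1) : ∑ j with w j = 1, colSign u k j = 0 := by
  have e1 : ∑ j with w j = 1, colGram u k j = 20 := by
    have := hf.sum_colGram_mul_weight h k
    rw [hk, mul_one] at this
    rw [← this, Finset.sum_filter]
    refine Finset.sum_congr rfl fun j _ => ?_
    rcases hf.weight_eq_zero_or_one h j with e | e <;> simp [e]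
  simp only [colSign, Finset.sum_sub_distrib, Finset.sum_add_distrib, e1, Finset.sum_const,
    hf.card_weight_one h]
  rw [Finset.sum_ite_eq, if_pos (by simp [hk])]
  norm_num

theorem sum_colSign_mul_colSign (hf : G.IsIntegralFrame u w) (h : G.IsSRGWith 50 7 0 1)
    {k l : Fin m} (hk : w k = 1) (hl : w l = 1) :
    ∑ j with w j = 1, colSign u k j * colSign u l j = 10 * colSign u k l := by
  have e0 : ∀ {i : Fin m}, w i = 1 → ∀ j, w j = 0 → colGram u i j = 0 := fun {i} hi j hj =>
    hf.colGram_eq_zero h hj fun e => by rw [e, hj] at hi; exact zero_ne_one hi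
  have e1 : ∑ j with w j = 1, (colGram u k j - 1) * (colGram u l j - 1) =
      10 * (colGram u k l - 1) := by
    have := hf.sum_mul_self h k l
    rw [hk, hl, one_mul] at this
    rw [← this, Finset.sum_filter]
    refine Finset.sum_congr rfl fun j _ => ?_
    rcases hf.weight_eq_zero_or_one h j with e | e <;> simp [e, e0 hk, e0 hl]
  have e2 : ∑ j with w j = 1, (if k = j then 10 else 0) * (if l = j then 10 else 0) =
      if k = l then (100 : ℤ) else 0 := by
    have : ∀ j, (if k = j then (10 : ℤ) else 0) * (if l = j then 10 else 0) =
        if k = j then (if k = l then 100 else 0) else 0 := fun j => by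
      by_cases a : k = j
      · subst a
        by_cases b : k = l
        · simp [b]
        · simp [b, Ne.symm b]
      · simp [a]
    rw [Finset.sum_congr rfl fun j _ => this j, Finset.sum_ite_eq, if_pos (by simp [hk])]
  have e3 : ∀ {a b : Fin m}, w a = 1 →
      ∑ j with w j = 1, (if a = j then 10 else 0) * (colGram u b j - 1) =
      10 * (colGram u b a - 1) := fun {a b} ha => by
    simp only [ite_mul, zero_mul]
    rw [Finset.sum_ite_eq, if_pos (by simp [ha])]
  calc _ = ∑ j with w j = 1, ((if k = j then 10 else 0) * (if l = j then 10 else 0)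
          - (if k = j then 10 else 0) * (colGram u l j - 1)
          - (if l = j then 10 else 0) * (colGram u k j - 1)
          + (colGram u k j - 1) * (colGram u l j - 1)) :=
        Finset.sum_congr rfl fun j _ => by rw [colSign, colSign]; ring
    _ = _ := by
        rw [Finset.sum_add_distrib, Finset.sum_sub_distrib, Finset.sum_sub_distrib, e1, e2,
          e3 hk, e3 hl, colSign, colGram_comm u l k]
        split_ifs <;> ring

/-- By the Cauchy–Schwarz inequality the ten entries of a row of `colSign` are at most `1` in
absolute value, while their squares add up to `10`. -/
theorem colSign_eq (hf : G.IsIntegralFrame u w) (h : G.IsSRGWith 50 7 0 1)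
    {k l : Fin m} (hk : w k = 1) (hl : w l = 1) : colSign u k l = 1 ∨ colSign u k l = -1 := by
  have hle : ∀ {l}, w l = 1 → colSign u k l * colSign u k l ≤ 1 := fun {l} hl => by
    have h1 : 0 ≤ ∑ j with w j = 1, (colSign u k j - colSign u l j) ^ 2 :=
      Finset.sum_nonneg fun j _ => sq_nonneg _
    have h2 : 0 ≤ ∑ j with w j = 1, (colSign u k j + colSign u l j) ^ 2 :=
      Finset.sum_nonneg fun j _ => sq_nonneg _
    have e1 : ∀ j, (colSign u k j - colSign u l j) ^ 2 = colSign u k j * colSign u k j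
      - 2 * (colSign u k j * colSign u l j) + colSign u l j * colSign u l j := fun j => by ring
    have e2 : ∀ j, (colSign u k j + colSign u l j) ^ 2 = colSign u k j * colSign u k j
      + 2 * (colSign u k j * colSign u l j) + colSign u l j * colSign u l j := fun j => by ring
    simp only [e1, e2, Finset.sum_add_distrib, Finset.sum_sub_distrib, ← Finset.mul_sum,
      hf.sum_colSign_mul_colSign h hk hk, hf.sum_colSign_mul_colSign h hk hl,
      hf.sum_colSign_mul_colSign h hl hl, hf.colSign_self h hk, hf.colSign_self h hl] at h1 h2
    nlinarith
  have hsum : ∑ j with w j = 1, (1 - colSign u k j * colSign u k j) = 0 := by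
    rw [Finset.sum_sub_distrib, hf.sum_colSign_mul_colSign h hk hk, Finset.sum_const,
      hf.card_weight_one h, hf.colSign_self h hk]
    norm_num
  have := (Finset.sum_eq_zero_iff_of_nonneg fun j hj =>
    sub_nonneg.2 (hle (Finset.mem_filter.1 hj).2)).1 hsum l (by simp [hl])
  exact mul_self_eq_one_iff.1 (sub_eq_zero.1 this).symm

theorem colSign_eq_mul (hf : G.IsIntegralFrame u w) (h : G.IsSRGWith 50 7 0 1)
    {k l j : Fin m} (hk : w k = 1) (hl : w l = 1) (hj : w j = 1) :
    colSign u k j = colSign u k l * colSign u l j := by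
  have hsum : ∑ j with w j = 1, (colSign u k j - colSign u k l * colSign u l j) ^ 2 = 0 := by
    have e1 : ∀ j, (colSign u k j - colSign u k l * colSign u l j) ^ 2 =
        colSign u k j * colSign u k j
        - 2 * colSign u k l * (colSign u k j * colSign u l j)
        + colSign u k l * colSign u k l * (colSign u l j * colSign u l j) := fun j => by ring
    simp only [e1, Finset.sum_add_distrib, Finset.sum_sub_distrib, ← Finset.mul_sum,
      hf.sum_colSign_mul_colSign h hk hk, hf.sum_colSign_mul_colSign h hk hl,
      hf.sum_colSign_mul_colSign h hl hl, hf.colSign_self h hk, hf.colSign_self h hl]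
    have := mul_self_eq_one_iff.2 (hf.colSign_eq h hk hl)
    linear_combination (-10) * this
  have := (Finset.sum_eq_zero_iff_of_nonneg fun j _ => sq_nonneg _).1 hsum j (by simp [hj])
  exact sub_eq_zero.1 (pow_eq_zero_iff two_ne_zero |>.1 this)

/-- The supports of the columns of weight `1` form two families of five Petersen sets. -/
theorem exists_grid (hf : G.IsIntegralFrame u w) (h : G.IsSRGWith 50 7 0 1) :
    ∃ S T : Fin 5 → Finset V, (∀ i, G.IsPetersenSet (S i)) ∧ (∀ i, G.IsPetersenSet (T i)) ∧
      (∀ i j, i ≠ j → Disjoint (S i) (S j)) ∧ (∀ i j, i ≠ j → Disjoint (T i) (T j)) ∧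
      ∀ i j, (S i ∩ T j).card = 2 := by
  classical
  obtain ⟨I, hI⟩ : ∃ I : Finset (Fin m), I = Finset.univ.filter fun k => w k = 1 := ⟨_, rfl⟩
  have hmem : ∀ k, k ∈ I ↔ w k = 1 := fun k => by simp [hI]
  obtain ⟨o, ho⟩ : I.Nonempty := Finset.card_pos.1 (by rw [hI, hf.card_weight_one h]; norm_num)
  have ho : w o = 1 := (hmem o).1 ho
  have hcard : (I.filter fun k => colSign u o k = 1).card +
      (I.filter fun k => ¬ colSign u o k = 1).card = 10 := by
    rw [Finset.card_filter_add_card_filter_not, hI, hf.card_weight_one h]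
  have hsum : ((I.filter fun k => colSign u o k = 1).card : ℤ) -
      (I.filter fun k => ¬ colSign u o k = 1).card = 0 := by
    rw [← hf.sum_colSign h ho, ← hI, ← Finset.sum_filter_add_sum_filter_not _ (fun k => colSign u o k = 1),
      Finset.sum_congr rfl fun k hk => (Finset.mem_filter.1 hk).2,
      Finset.sum_congr (s₁ := Finset.filter (fun k => ¬ colSign u o k = 1) _) rfl fun k hk =>
        (hf.colSign_eq h ho ((hmem k).1 (Finset.mem_filter.1 hk).1)).resolve_left
          (Finset.mem_filter.1 hk).2]
    simp [sub_eq_add_neg]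
  have c1 : (I.filter fun k => colSign u o k = 1).card = 5 := by omega
  have c2 : (I.filter fun k => ¬ colSign u o k = 1).card = 5 := by omega
  let a := (Finset.equivFinOfCardEq c1).symm
  let b := (Finset.equivFinOfCardEq c2).symm
  have ha : ∀ i, w (a i) = 1 ∧ colSign u o (a i) = 1 := fun i => by
    have := Finset.mem_filter.1 (a i).2
    exact ⟨(hmem _).1 this.1, this.2⟩
  have hb : ∀ i, w (b i) = 1 ∧ colSign u o (b i) = -1 := fun i => by
    have := Finset.mem_filter.1 (b i).2
    have hw := (hmem _).1 this.1
    exact ⟨hw, (hf.colSign_eq h ho hw).resolve_left this.2⟩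
  have hdisj : ∀ {k l : Fin m}, w k = 1 → w l = 1 → k ≠ l → colSign u o k = colSign u o l →
      Disjoint (colSupport u k) (colSupport u l) := fun {k l} hk hl hkl e => by
    rw [Finset.disjoint_iff_inter_eq_empty, ← Finset.card_eq_zero]
    have e1 := hf.card_colSupport_inter h hk hl
    have e2 := hf.colSign_eq_mul h hk ho hl
    rw [colSign_comm u k o, e, mul_self_eq_one_iff.2 (hf.colSign_eq h ho hl), colSign,
      if_neg hkl] at e2
    omega
  refine ⟨fun i => colSupport u (a i), fun j => colSupport u (b j),
    fun i => hf.isPetersenSet h (ha i).1, fun i => hf.isPetersenSet h (hb i).1,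
    fun i j hij => hdisj (ha i).1 (ha j).1 ?_ ((ha i).2.trans (ha j).2.symm),
    fun i j hij => hdisj (hb i).1 (hb j).1 ?_ ((hb i).2.trans (hb j).2.symm), fun i j => ?_⟩
  · exact fun e => hij (a.injective (Subtype.ext e))
  · exact fun e => hij (b.injective (Subtype.ext e))
  · have e1 := hf.card_colSupport_inter h (ha i).1 (hb j).1
    have e2 := hf.colSign_eq_mul h (ha i).1 ho (hb j).1
    have e3 : (a i : Fin m) ≠ b j := fun e => by
      have := (ha i).2
      rw [e, (hb j).2] at this
      norm_num at this
    rw [colSign_comm u _ o, (ha i).2, (hb j).2, colSign, if_neg e3] at e2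
    simp only
    omega

end IsIntegralFrame

end SimpleGraph

/-! ### Relations on five columns -/

/-- The self-map of `Fin 5` with the given values. -/
def fiveTuple (a b c d e : Fin 5) : Fin 5 → Fin 5 := ![a, b, c, d, e]

theorem eq_fiveTuple (σ : Fin 5 → Fin 5) : σ = fiveTuple (σ 0) (σ 1) (σ 2) (σ 3) (σ 4) := by
  ext j
  fin_cases j <;> rfl

/-- A fixed-point-free injection of a five-element set without `2`-cycles is a `5`-cycle. -/
theorem exists_cyclic_labelling {σ : Fin 5 → Fin 5} (hσ : Function.Injective σ)
    (h1 : ∀ j, σ j ≠ j) (h2 : ∀ j, σ (σ j) ≠ j) :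
    ∃ e : Fin 5 → Fin 5, Function.Injective e ∧ ∀ k, σ (e k) = e (k + 1) := by
  have key : ∀ a b c d e : Fin 5, (∀ j, fiveTuple a b c d e j ≠ j) →
      (∀ j, fiveTuple a b c d e (fiveTuple a b c d e j) ≠ j) →
      (∀ i j, fiveTuple a b c d e i = fiveTuple a b c d e j → i = j) →
      (∀ i j : Fin 5, (fiveTuple a b c d e)^[i] 0 = (fiveTuple a b c d e)^[j] 0 → i = j) ∧
      ∀ k : Fin 5, fiveTuple a b c d e ((fiveTuple a b c d e)^[k] 0) =
        (fiveTuple a b c d e)^[(k + 1 : Fin 5)] 0 := by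
    decide +kernel
  have := key (σ 0) (σ 1) (σ 2) (σ 3) (σ 4)
  rw [← eq_fiveTuple] at this
  obtain ⟨k1, k2⟩ := this h1 h2 fun i j hij => hσ hij
  exact ⟨fun k => σ^[k] 0, fun i j => k1 i j, k2⟩

/-- The relation on `Fin 5` in which `j` is related to `j + d` and `o j`. -/
def pairConfig (d : Fin 5) (o : Fin 5 → Fin 5) (j l : Fin 5) : Bool := l == j + d || l == o j

/-- For pairwise distinct `j, l, n`, the relation `r` separates `l` from `n` at `j`, or `j` from
`n` at `l`. -/
def IsTripleFree (r : Fin 5 → Fin 5 → Bool) : Prop :=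
  ∀ j l, j ≠ l → ∀ n, j ≠ n → l ≠ n → ¬ (r j l = r j n ∧ r l j = r l n)

/-- The condition on the relations `r`, `r'` of two rows which says that there is no quadrangle
`x ∼ y ∼ y' ∼ x'` with `x, y` in the first and `x', y'` in the second row, when the vertices that
start the edges described by `r` are joined to their counterparts in the same column, and the other
vertices of the cells to the other vertices in the next column. -/
def IsCompatible (r r' : Fin 5 → Fin 5 → Bool) : Prop :=
  ∀ j l, j ≠ l → ¬ (r j l = true ∧ r l j = true ∧ r' j l = true ∧ r' l j = true) ∧
    ¬ (r j l = false ∧ r l j = false ∧ r' (j + 1) (l + 1) = false ∧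
      r' (l + 1) (j + 1) = false) ∧
    (j ≠ l + 1 → ¬ (r j l = true ∧ r l j = false ∧ r' j (l + 1) = true ∧ r' (l + 1) j = false))

instance (r : Fin 5 → Fin 5 → Bool) : Decidable (IsTripleFree r) := by
  unfold IsTripleFree; infer_instance

instance (r r' : Fin 5 → Fin 5 → Bool) : Decidable (IsCompatible r r') := by
  unfold IsCompatible; infer_instance

theorem pairConfig_not_isCompatible : ∀ a b c d e : Fin 5,
    (∀ j, fiveTuple a b c d e j ≠ j ∧ fiveTuple a b c d e j ≠ j + 1) →
    IsTripleFree (pairConfig 1 (fiveTuple a b c d e)) →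
    ∀ a' b' c' d' e' : Fin 5,
    (∀ j, fiveTuple a' b' c' d' e' j ≠ j ∧ fiveTuple a' b' c' d' e' j ≠ j + 4) →
    IsTripleFree (pairConfig 4 (fiveTuple a' b' c' d' e')) →
    ¬ IsCompatible (pairConfig 1 (fiveTuple a b c d e))
      (pairConfig 4 (fiveTuple a' b' c' d' e')) := by
  decide +kernel

theorem exists_pairConfig {r : Fin 5 → Fin 5 → Bool} {d : Fin 5} (hd : d ≠ 0)
    (hr : ∀ j, r j (j + d) = true)
    (hc : ∀ j, (Finset.univ.filter fun l => l ≠ j ∧ r j l = true).card = 2) :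
    ∃ o : Fin 5 → Fin 5, (∀ j, o j ≠ j ∧ o j ≠ j + d) ∧
      ∀ j l, j ≠ l → r j l = pairConfig d o j l := by
  have hj : ∀ j, j + d ≠ j := fun j e => hd (by simpa using e)
  have : ∀ j, ∃ o, (o ≠ j ∧ o ≠ j + d) ∧ ∀ l, j ≠ l → r j l = (l == j + d || l == o) := by
    intro j
    have hmem : j + d ∈ Finset.univ.filter fun l => l ≠ j ∧ r j l = true := by simp [hj, hr]
    have h1 := Finset.card_erase_of_mem hmem
    rw [hc j] at h1
    obtain ⟨o, ho⟩ := Finset.card_eq_one.1 h1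
    have hall : ∀ l, (l ≠ j + d ∧ l ≠ j ∧ r j l = true) ↔ l = o := fun l => by
      have := Finset.ext_iff.1 ho l
      simpa using this
    refine ⟨o, ⟨((hall o).2 rfl).2.1, ((hall o).2 rfl).1⟩, fun l hl => ?_⟩
    rw [Bool.eq_iff_iff]
    simp only [Bool.or_eq_true, beq_iff_eq]
    constructor
    · intro h
      by_cases e : l = j + d
      · exact Or.inl e
      · exact Or.inr ((hall l).1 ⟨e, hl.symm, h⟩)
    · rintro (e | e)
      · rw [e, hr]
      · exact ((hall l).2 e).2.2
  choose o ho using this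
  exact ⟨o, fun j => (ho j).1, fun j => (ho j).2⟩

/-- No two relations satisfy all the conditions that two rows of a grid of Petersen sets impose. -/
theorem not_isCompatible {r r' : Fin 5 → Fin 5 → Bool}
    (hr : ∀ j, r j (j + 1) = true) (hr' : ∀ j, r' (j + 1) j = true)
    (hc : ∀ j, (Finset.univ.filter fun l => l ≠ j ∧ r j l = true).card = 2)
    (hc' : ∀ j, (Finset.univ.filter fun l => l ≠ j ∧ r' j l = true).card = 2)
    (ht : IsTripleFree r) (ht' : IsTripleFree r') : ¬ IsCompatible r r' := by
  intro hcomp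
  obtain ⟨o, ho, hro⟩ := exists_pairConfig (by decide) hr hc
  obtain ⟨o', ho', hro'⟩ := exists_pairConfig (d := 4) (by decide) (fun j => by
    have := hr' (j + 4)
    rwa [(by decide : ∀ i : Fin 5, i + 4 + 1 = i) j] at this) hc'
  have t : IsTripleFree (pairConfig 1 o) := fun j l hjl n hjn hln => by
    rw [← hro j l hjl, ← hro j n hjn, ← hro l j hjl.symm, ← hro l n hln]
    exact ht j l hjl n hjn hln
  have t' : IsTripleFree (pairConfig 4 o') := fun j l hjl n hjn hln => by
    rw [← hro' j l hjl, ← hro' j n hjn, ← hro' l j hjl.symm, ← hro' l n hln]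
    exact ht' j l hjl n hjn hln
  have c : IsCompatible (pairConfig 1 o) (pairConfig 4 o') := fun j l hjl => by
    have hne : j + 1 ≠ l + 1 := fun e => hjl (by simpa using e)
    rw [← hro j l hjl, ← hro l j hjl.symm, ← hro' j l hjl, ← hro' l j hjl.symm, ← hro' _ _ hne,
      ← hro' _ _ hne.symm]
    refine ⟨(hcomp j l hjl).1, (hcomp j l hjl).2.1, fun hne' => ?_⟩
    rw [← hro' _ _ hne', ← hro' _ _ hne'.symm]
    exact (hcomp j l hjl).2.2 hne'
  rw [eq_fiveTuple o] at t c ho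
  rw [eq_fiveTuple o'] at t' c ho'
  exact pairConfig_not_isCompatible _ _ _ _ _ ho t _ _ _ _ _ ho' t' c

/-! ### Edges between the cells of a grid -/

namespace SimpleGraph

variable {V : Type*} {G : SimpleGraph V} [DecidableRel G.Adj]

theorem IsPetersenSet.eq_of_adj {S : Finset V} (hS : G.IsPetersenSet S) {x y z : V} (hx : x ∉ S)
    (hy : y ∈ S) (hz : z ∈ S) (hxy : G.Adj x y) (hxz : G.Adj x z) : y = z :=
  Finset.card_le_one.1 (hS.outside x hx).le y (Finset.mem_filter.2 ⟨hy, hxy⟩) z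
    (Finset.mem_filter.2 ⟨hz, hxz⟩)

theorem IsPetersenSet.exists_adj {S : Finset V} (hS : G.IsPetersenSet S) {x : V} (hx : x ∉ S) :
    ∃ y ∈ S, G.Adj x y := by
  obtain ⟨y, hy⟩ := Finset.card_pos.1 (by rw [hS.outside x hx]; exact one_pos)
  exact ⟨y, Finset.mem_filter.1 hy⟩

variable [DecidableEq V]

/-- Two families of five pairwise disjoint Petersen sets, the rows `S i` and the columns `T j`, such
that each of the cells `S i ∩ T j` has two elements. -/
structure IsPetersenGrid (G : SimpleGraph V) [DecidableRel G.Adj] (S T : Fin 5 → Finset V) :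
    Prop where
  row : ∀ i, G.IsPetersenSet (S i)
  col : ∀ j, G.IsPetersenSet (T j)
  row_disjoint : ∀ i j, i ≠ j → Disjoint (S i) (S j)
  col_disjoint : ∀ i j, i ≠ j → Disjoint (T i) (T j)
  card_cell : ∀ i j, (S i ∩ T j).card = 2

namespace IsPetersenGrid

variable {S T : Fin 5 → Finset V}

theorem swap (hg : G.IsPetersenGrid S T) : G.IsPetersenGrid T S :=
  ⟨hg.col, hg.row, hg.col_disjoint, hg.row_disjoint, fun i j => by
    rw [Finset.inter_comm, hg.card_cell]⟩

theorem col_eq (hg : G.IsPetersenGrid S T) {x : V} {j l : Fin 5} (hj : x ∈ T j) (hl : x ∈ T l) :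
    j = l := by
  by_contra hne
  exact Finset.disjoint_left.1 (hg.col_disjoint j l hne) hj hl

theorem exists_col (hg : G.IsPetersenGrid S T) {i : Fin 5} {x : V} (hx : x ∈ S i) :
    ∃ j, x ∈ T j := by
  have hsub : Finset.univ.biUnion (fun j => S i ∩ T j) ⊆ S i :=
    Finset.biUnion_subset.2 fun j _ => Finset.inter_subset_left
  have hcard : (Finset.univ.biUnion fun j => S i ∩ T j).card = 10 := by
    rw [Finset.card_biUnion fun j _ l _ hjl =>
      (hg.col_disjoint j l hjl).mono Finset.inter_subset_right Finset.inter_subset_right]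
    simp [hg.card_cell]
  rw [← Finset.eq_of_subset_of_card_le hsub (by rw [hcard, (hg.row i).card_eq])] at hx
  obtain ⟨j, -, hj⟩ := Finset.mem_biUnion.1 hx
  exact ⟨j, Finset.mem_of_mem_inter_right hj⟩

variable [Fintype V]

/-- The two vertices of a cell are adjacent: otherwise their common neighbour, which cannot lie
outside of a Petersen set containing both, would be a third element of the cell. -/
theorem adj_of_mem_cell (hg : G.IsPetersenGrid S T) (h : G.IsSRGWith 50 7 0 1) {i j : Fin 5}
    {x y : V} (hx : x ∈ S i ∩ T j) (hy : y ∈ S i ∩ T j) (hxy : x ≠ y) : G.Adj x y := by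
  by_contra hn
  obtain ⟨z, hxz, hzy⟩ := h.exists_common_neighbor hxy hn
  have hmem : ∀ P : Finset V, G.IsPetersenSet P → x ∈ P → y ∈ P → z ∈ P := fun P hP h1 h2 => by
    by_contra h3
    exact hxy (hP.eq_of_adj h3 h1 h2 hxz.symm hzy)
  rw [Finset.mem_inter] at hx hy
  have hz : z ∈ S i ∩ T j :=
    Finset.mem_inter.2 ⟨hmem _ (hg.row i) hx.1 hy.1, hmem _ (hg.col j) hx.2 hy.2⟩
  have := Finset.card_le_card (show {x, y, z} ⊆ S i ∩ T j by
    intro t ht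
    simp only [Finset.mem_insert, Finset.mem_singleton] at ht
    rcases ht with rfl | rfl | rfl
    · exact Finset.mem_inter.2 hx
    · exact Finset.mem_inter.2 hy
    · exact hz)
  rw [hg.card_cell, Finset.card_eq_three.2 ⟨x, y, z, hxy, hxz.ne, hzy.ne', rfl⟩] at this
  omega

/-- The other vertex of a cell. -/
theorem exists_mate (hg : G.IsPetersenGrid S T) (h : G.IsSRGWith 50 7 0 1) {i j : Fin 5}
    {x : V} (hx : x ∈ S i ∩ T j) :
    ∃ y, y ∈ S i ∩ T j ∧ G.Adj x y ∧ ∀ z ∈ S i ∩ T j, z = x ∨ z = y := by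
  have h1 := Finset.card_erase_of_mem hx
  rw [hg.card_cell] at h1
  obtain ⟨y, hy⟩ := Finset.card_eq_one.1 h1
  have hall : ∀ z, (z ≠ x ∧ z ∈ S i ∩ T j) ↔ z = y := fun z => by
    rw [← Finset.mem_erase, hy, Finset.mem_singleton]
  obtain ⟨hyx, hy'⟩ := (hall y).2 rfl
  refine ⟨y, hy', hg.adj_of_mem_cell h hx hy' hyx.symm, fun z hz => ?_⟩
  by_cases e : z = x
  · exact Or.inl e
  · exact Or.inr ((hall z).1 ⟨e, hz⟩)

/-- At most one edge joins two cells of the same row: two disjoint edges would form a quadrangle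
with the edges inside the cells. -/
theorem cell_edge_unique (hg : G.IsPetersenGrid S T) (h : G.IsSRGWith 50 7 0 1) {i j l : Fin 5}
    (hjl : j ≠ l) {x y x' y' : V} (hx : x ∈ S i ∩ T j) (hx' : x' ∈ S i ∩ T j)
    (hy : y ∈ S i ∩ T l) (hy' : y' ∈ S i ∩ T l) (hxy : G.Adj x y) (hxy' : G.Adj x' y') :
    x = x' ∧ y = y' := by
  have nT : ∀ {j l : Fin 5} {x : V}, j ≠ l → x ∈ S i ∩ T j → x ∉ T l := fun hjl hx hxl =>
    hjl (hg.col_eq (Finset.mem_of_mem_inter_right hx) hxl)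
  have mT : ∀ {j : Fin 5} {x : V}, x ∈ S i ∩ T j → x ∈ T j := fun hx =>
    Finset.mem_of_mem_inter_right hx
  by_cases e : x = x'
  · subst e
    exact ⟨rfl, (hg.col l).eq_of_adj (nT hjl hx) (mT hy) (mT hy') hxy hxy'⟩
  by_cases e' : y = y'
  · subst e'
    exact absurd ((hg.col j).eq_of_adj (nT hjl.symm hy) (mT hx) (mT hx') hxy.symm hxy'.symm) e
  have a := hg.adj_of_mem_cell h hx hx' e
  have a' := hg.adj_of_mem_cell h hy hy' e'
  have hne : x ≠ y' := fun e => nT hjl hx (e ▸ mT hy')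
  have := h.eq_of_common_neighbor hne hxy a' a hxy'
  exact absurd (this ▸ mT hy) (nT hjl hx')

/-- The four edges that leave a cell inside its row go to four different cells. -/
theorem exists_cell_edge (hg : G.IsPetersenGrid S T) (h : G.IsSRGWith 50 7 0 1) {i j l : Fin 5}
    (hjl : j ≠ l) : ∃ x ∈ S i ∩ T j, ∃ y ∈ S i ∩ T l, G.Adj x y := by
  obtain ⟨x, hx⟩ := Finset.card_pos.1 (by rw [hg.card_cell i j]; norm_num)
  obtain ⟨x', hx', hxx', hcell⟩ := hg.exists_mate h hx
  have hS : ∀ {j : Fin 5} {x : V}, x ∈ S i ∩ T j → x ∈ S i := fun hx =>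
    Finset.mem_of_mem_inter_left hx
  set D := ((S i).filter (G.Adj x)).erase x' ∪ ((S i).filter (G.Adj x')).erase x with hD
  have hcardD : D.card = 4 := by
    rw [hD, Finset.card_union_of_disjoint, Finset.card_erase_of_mem, Finset.card_erase_of_mem,
      (hg.row i).inside x (hS hx), (hg.row i).inside x' (hS hx')]
    · exact Finset.mem_filter.2 ⟨hS hx, hxx'.symm⟩
    · exact Finset.mem_filter.2 ⟨hS hx', hxx'⟩
    · rw [Finset.disjoint_left]
      intro y hy hy'
      have h1 := (Finset.mem_filter.1 (Finset.mem_of_mem_erase hy)).2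
      have h2 := (Finset.mem_filter.1 (Finset.mem_of_mem_erase hy')).2
      exact h.not_adj_of_adj_of_adj h1 h2.symm hxx'
  have hDspec : ∀ y ∈ D, y ∈ S i ∧ y ≠ x ∧ y ≠ x' ∧ ∃ v ∈ S i ∩ T j, G.Adj v y := by
    intro y hy
    rcases Finset.mem_union.1 hy with hy | hy <;> rw [Finset.mem_erase, Finset.mem_filter] at hy
    · exact ⟨hy.2.1, hy.2.2.ne', hy.1, x, hx, hy.2.2⟩
    · exact ⟨hy.2.1, hy.1, hy.2.2.ne', x', hx', hy.2.2⟩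
  have hcol : ∀ y : V, ∃ c, y ∈ D → y ∈ T c := fun y => by
    by_cases hy : y ∈ D
    · obtain ⟨c, hc⟩ := hg.exists_col (hDspec y hy).1
      exact ⟨c, fun _ => hc⟩
    · exact ⟨0, fun h => absurd h hy⟩
  choose c hc using hcol
  have hcj : ∀ y ∈ D, c y ≠ j := fun y hy e => by
    obtain ⟨h1, h2, h3, -⟩ := hDspec y hy
    rcases hcell y (Finset.mem_inter.2 ⟨h1, e ▸ hc y hy⟩) with e | e
    · exact h2 e
    · exact h3 e
  have himg : (D.image c).card = 4 := by
    rw [Finset.card_image_of_injOn, hcardD]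
    intro y hy y' hy' e
    obtain ⟨h1, -, -, v, hv, hvy⟩ := hDspec y hy
    obtain ⟨h1', -, -, v', hv', hvy'⟩ := hDspec y' hy'
    exact (hg.cell_edge_unique h (hcj y hy).symm hv hv' (Finset.mem_inter.2 ⟨h1, hc y hy⟩)
      (Finset.mem_inter.2 ⟨h1', e ▸ hc y' hy'⟩) hvy hvy').2
  have hall : D.image c = Finset.univ.erase j := by
    refine Finset.eq_of_subset_of_card_le (fun a ha => ?_) ?_
    · obtain ⟨y, hy, rfl⟩ := Finset.mem_image.1 ha
      exact Finset.mem_erase.2 ⟨hcj y hy, Finset.mem_univ _⟩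
    · rw [himg, Finset.card_erase_of_mem (Finset.mem_univ _)]
      simp
  obtain ⟨y, hy, rfl⟩ := Finset.mem_image.1
    (hall ▸ Finset.mem_erase.2 ⟨hjl.symm, Finset.mem_univ l⟩ : l ∈ D.image c)
  obtain ⟨h1, -, -, v, hv, hvy⟩ := hDspec y hy
  exact ⟨v, hv, y, Finset.mem_inter.2 ⟨h1, hc y hy⟩, hvy⟩

end IsPetersenGrid

end SimpleGraph

/-! ### Two rows of a grid -/

namespace SimpleGraph

namespace IsPetersenGrid

variable {V : Type*} [Fintype V] [DecidableEq V] {G : SimpleGraph V} [DecidableRel G.Adj]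
  {S T : Fin 5 → Finset V}

theorem eq_or_eq_of_mem_cell (hg : G.IsPetersenGrid S T) (h : G.IsSRGWith 50 7 0 1) {i j : Fin 5}
    {x y z : V} (hx : x ∈ S i ∩ T j) (hy : y ∈ S i ∩ T j) (hxy : G.Adj x y)
    (hz : z ∈ S i ∩ T j) : z = x ∨ z = y := by
  obtain ⟨y', -, -, hy'⟩ := hg.exists_mate h hx
  rw [(hy' y hy).resolve_left hxy.ne']
  exact hy' z hz

/-- The edges between the cells of a row are described by a relation `r` on the columns, where
`r j l` means that the edge between the cells `j` and `l` starts at `s j` and not at the other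
vertex `m j` of the cell. -/
theorem exists_row_relation (hg : G.IsPetersenGrid S T) (h : G.IsSRGWith 50 7 0 1) {i : Fin 5}
    {s m : Fin 5 → V} (hs : ∀ j, s j ∈ S i ∩ T j) (hm : ∀ j, m j ∈ S i ∩ T j)
    (hsm : ∀ j, G.Adj (s j) (m j)) :
    ∃ r : Fin 5 → Fin 5 → Bool,
      (∀ j l, j ≠ l → G.Adj (cond (r j l) (s j) (m j)) (cond (r l j) (s l) (m l))) ∧
      (∀ j, (Finset.univ.filter fun l => l ≠ j ∧ r j l = true).card = 2) ∧ IsTripleFree r := by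
  classical
  have hcond : ∀ b j, cond b (s j) (m j) ∈ S i ∩ T j := fun b j => by
    cases b
    · exact hm j
    · exact hs j
  have hcol : ∀ b j, cond b (s j) (m j) ∈ T j := fun b j =>
    Finset.mem_of_mem_inter_right (hcond b j)
  have hrow : ∀ b j, cond b (s j) (m j) ∈ S i := fun b j =>
    Finset.mem_of_mem_inter_left (hcond b j)
  have hcolne : ∀ b b' {j l}, j ≠ l → cond b (s j) (m j) ≠ cond b' (s l) (m l) :=
    fun b b' j l hjl e => hjl (hg.col_eq (hcol b j) (e ▸ hcol b' l))
  obtain ⟨r, hr⟩ : ∃ r : Fin 5 → Fin 5 → Bool, ∀ j l, r j l = true ↔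
      ∃ z ∈ S i ∩ T l, G.Adj (s j) z :=
    ⟨fun j l => decide (∃ z ∈ S i ∩ T l, G.Adj (s j) z), fun j l => by simp⟩
  have hstart : ∀ {j l x y}, j ≠ l → x ∈ S i ∩ T j → y ∈ S i ∩ T l → G.Adj x y →
      x = cond (r j l) (s j) (m j) := fun {j l x y} hjl hx hy hxy => by
    rcases hg.eq_or_eq_of_mem_cell h (hs j) (hm j) (hsm j) hx with rfl | rfl
    · rw [(hr j l).2 ⟨y, hy, hxy⟩, cond_true]
    · have : r j l = false := by
        rw [← Bool.not_eq_true, hr]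
        rintro ⟨z, hz, hz'⟩
        exact (hsm j).ne (hg.cell_edge_unique h hjl (hs j) hx hz hy hz' hxy).1
      rw [this, cond_false]
  have hedge : ∀ j l, j ≠ l →
      G.Adj (cond (r j l) (s j) (m j)) (cond (r l j) (s l) (m l)) := fun j l hjl => by
    obtain ⟨x, hx, y, hy, hxy⟩ := hg.exists_cell_edge h (i := i) hjl
    rwa [← hstart hjl hx hy hxy, ← hstart hjl.symm hy hx hxy.symm]
  refine ⟨r, hedge, fun j => ?_, fun j l hjl n hjn hln => ?_⟩
  · have hsS : s j ∈ S i := Finset.mem_of_mem_inter_left (hs j)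
    have hDspec : ∀ y ∈ ((S i).filter (G.Adj (s j))).erase (m j),
        y ∈ S i ∧ G.Adj (s j) y ∧ y ≠ m j := fun y hy => by
      rw [Finset.mem_erase, Finset.mem_filter] at hy
      exact ⟨hy.2.1, hy.2.2, hy.1⟩
    have hcard : (((S i).filter (G.Adj (s j))).erase (m j)).card = 2 := by
      rw [Finset.card_erase_of_mem, (hg.row i).inside _ hsS]
      exact Finset.mem_filter.2 ⟨Finset.mem_of_mem_inter_left (hm j), hsm j⟩
    have hc : ∀ y : V, ∃ c, y ∈ S i → y ∈ T c := fun y => by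
      by_cases hy : y ∈ S i
      · obtain ⟨c, hc⟩ := hg.exists_col hy
        exact ⟨c, fun _ => hc⟩
      · exact ⟨0, fun h => absurd h hy⟩
    choose c hc using hc
    have hcj : ∀ y ∈ ((S i).filter (G.Adj (s j))).erase (m j), c y ≠ j := fun y hy e => by
      obtain ⟨h1, h2, h3⟩ := hDspec y hy
      rcases hg.eq_or_eq_of_mem_cell h (hs j) (hm j) (hsm j)
        (Finset.mem_inter.2 ⟨h1, e ▸ hc y h1⟩) with e | e
      · exact h2.ne' e
      · exact h3 e
    rw [← hcard, ← Finset.card_image_of_injOn (f := c)]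
    · congr 1
      ext l
      simp only [Finset.mem_filter, Finset.mem_univ, true_and, Finset.mem_image]
      constructor
      · rintro ⟨hlj, hrl⟩
        have he := hedge j l hlj.symm
        rw [hrl, cond_true] at he
        refine ⟨_, Finset.mem_erase.2 ⟨?_, Finset.mem_filter.2 ⟨hrow (r l j) l, he⟩⟩, ?_⟩
        · exact hcolne (r l j) false hlj
        · exact hg.col_eq (hc _ (hrow _ _)) (hcol _ _)
      · rintro ⟨y, hy, rfl⟩
        obtain ⟨h1, h2, -⟩ := hDspec y hy
        exact ⟨hcj y hy, (hr _ _).2 ⟨y, Finset.mem_inter.2 ⟨h1, hc y h1⟩, h2⟩⟩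
    · intro y hy y' hy' e
      obtain ⟨h1, h2, -⟩ := hDspec y hy
      obtain ⟨h1', h2', -⟩ := hDspec y' hy'
      refine (hg.col (c y)).eq_of_adj (fun hj => hcj y hy ?_) (hc y h1) (e ▸ hc y' h1') h2 h2'
      exact hg.col_eq hj (hcol true j)
  · -- The three edges between the cells `j`, `l`, `n` would form a triangle, or a quadrangle
    -- together with the edge inside the cell `n`.
    rintro ⟨e1, e2⟩
    have a1 := hedge j l hjl
    have a2 := hedge j n hjn
    have a3 := hedge l n hln
    rw [← e1] at a2
    rw [← e2] at a3
    by_cases e : cond (r n j) (s n) (m n) = cond (r n l) (s n) (m n)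
    · exact h.not_adj_of_adj_of_adj a1 a3 (e ▸ a2)
    · have a4 := hg.adj_of_mem_cell h (hcond (r n j) n) (hcond (r n l) n) e
      exact hcolne _ _ hjn (h.eq_of_common_neighbor (hcolne _ _ hln.symm) a2.symm a1 a4 a3.symm)

end IsPetersenGrid

/-- Two rows of a grid of Petersen sets are joined by a perfect matching. In each column exactly
one of its edges `s j ∼ s' j` stays in the column, and the other vertices of the cells are joined
as `m j ∼ m' (σ j)`. The map `σ` is a `5`-cycle, and with the columns labelled along it the
relations of `exists_row_relation` for the two rows contradict `not_isCompatible`. -/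
theorem IsSRGWith.not_isPetersenGrid {V : Type*} [Fintype V] [DecidableEq V] {G : SimpleGraph V}
    [DecidableRel G.Adj] (h : G.IsSRGWith 50 7 0 1) (S T : Fin 5 → Finset V) :
    ¬ G.IsPetersenGrid S T := by
  intro hg
  have h01 : (0 : Fin 5) ≠ 1 := by decide
  have hS : ∀ {i j : Fin 5} {x : V}, x ∈ S i ∩ T j → x ∈ S i := Finset.mem_of_mem_inter_left
  have hT : ∀ {i j : Fin 5} {x : V}, x ∈ S i ∩ T j → x ∈ T j := Finset.mem_of_mem_inter_right
  have hS0 : ∀ {j : Fin 5} {x : V}, x ∈ S 1 ∩ T j → x ∉ S 0 := fun hx =>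
    Finset.disjoint_right.1 (hg.row_disjoint 0 1 h01) (hS hx)
  have hS1 : ∀ {j : Fin 5} {x : V}, x ∈ S 0 ∩ T j → x ∉ S 1 := fun hx =>
    Finset.disjoint_left.1 (hg.row_disjoint 0 1 h01) (hS hx)
  have hTn : ∀ {i j l : Fin 5} {x : V}, j ≠ l → x ∈ S i ∩ T j → x ∉ T l := fun hjl hx hxl =>
    hjl (hg.col_eq (hT hx) hxl)
  have hne : ∀ {i i' j l : Fin 5} {x y : V}, j ≠ l → x ∈ S i ∩ T j → y ∈ S i' ∩ T l → x ≠ y :=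
    fun hjl hx hy e => hTn hjl hx (e ▸ hT hy)
  have hcol : ∀ j, ∃ x y, x ∈ S 0 ∩ T j ∧ y ∈ S 1 ∩ T j ∧ G.Adj x y := fun j => by
    obtain ⟨x, hx, y, hy, hxy⟩ := hg.swap.exists_cell_edge h (i := j) h01
    rw [Finset.inter_comm] at hx hy
    exact ⟨x, y, hx, hy, hxy⟩
  choose s s' hs hs' hss' using hcol
  choose m hm hsm hmall using fun j => hg.exists_mate h (hs j)
  choose m' hm' hsm' hmall' using fun j => hg.exists_mate h (hs' j)
  have hσ : ∀ j, ∃ l, l ≠ j ∧ G.Adj (m j) (m' l) := fun j => by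
    obtain ⟨n, hn, hmn⟩ := (hg.row 1).exists_adj (hS1 (hm j))
    obtain ⟨l, hl⟩ := hg.exists_col hn
    -- The cells of column `j` in the two rows are joined by the edge `s j ∼ s' j` only.
    have hlj : l ≠ j := by
      rintro rfl
      have hm2 := hm l
      have hs2 := hs l
      have hs2' := hs' l
      rw [Finset.inter_comm] at hm2 hs2 hs2'
      exact (hsm l).ne (hg.swap.cell_edge_unique h h01 hs2 hm2 hs2'
        (Finset.mem_inter.2 ⟨hl, hn⟩) (hss' l) hmn).1
    refine ⟨l, hlj, ?_⟩
    -- The only neighbour of `s' l` in `S 0` is `s l`.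
    rcases hmall' l n (Finset.mem_inter.2 ⟨hn, hl⟩) with rfl | rfl
    · exact absurd ((hg.row 0).eq_of_adj (hS0 (hs' l)) (hS (hs l)) (hS (hm j)) (hss' l).symm
        hmn.symm) (hne hlj (hs l) (hm j))
    · exact hmn
  choose σ hσj hmm using hσ
  obtain ⟨r, hr, hrc, hrt⟩ := hg.exists_row_relation h hs hm hsm
  obtain ⟨r', hr', hrc', hrt'⟩ := hg.exists_row_relation h hs' hm' hsm'
  have hcond : ∀ b j, cond b (s j) (m j) ∈ S 0 ∩ T j := fun b j => by
    cases b
    · exact hm j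
    · exact hs j
  have hcond' : ∀ b j, cond b (s' j) (m' j) ∈ S 1 ∩ T j := fun b j => by
    cases b
    · exact hm' j
    · exact hs' j
  have hne01 : ∀ {j l : Fin 5} {x y : V}, x ∈ S 0 ∩ T j → y ∈ S 1 ∩ T l → x ≠ y :=
    fun hx hy e => hS1 hx (e ▸ hS hy)
  -- The only neighbour of `m j` in column `σ j` is `m' (σ j)`, and conversely, so within the rows
  -- the edges between the cells `j` and `σ j` start at `s j` and at `s' (σ j)`.
  have hσr : ∀ j, r j (σ j) = true := fun j => by
    by_contra hf
    have a := hr j (σ j) (hσj j).symm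
    rw [Bool.not_eq_true] at hf
    rw [hf, cond_false] at a
    exact hne01 (hcond _ _) (hm' (σ j)) ((hg.col (σ j)).eq_of_adj (hTn (hσj j).symm (hm j))
      (hT (hcond _ _)) (hT (hm' _)) a (hmm j))
  have hσr' : ∀ j, r' (σ j) j = true := fun j => by
    by_contra hf
    have a := hr' (σ j) j (hσj j)
    rw [Bool.not_eq_true] at hf
    rw [hf, cond_false] at a
    exact hne01 (hm j) (hcond' _ _) ((hg.col j).eq_of_adj (hTn (hσj j) (hm' _)) (hT (hm j))
      (hT (hcond' _ _)) (hmm j).symm a)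
  have hσinj : Function.Injective σ := fun j l e => by
    by_contra hjl
    exact hne hjl (hm j) (hm l) ((hg.row 0).eq_of_adj (hS0 (hm' (σ j))) (hS (hm j)) (hS (hm l))
      (hmm j).symm (e ▸ (hmm l).symm))
  -- A quadrangle consists of two edges between the rows and one edge in each row.
  have quad : ∀ {j l j' l' : Fin 5} {x y x' y' : V}, x ∈ S 0 ∩ T j → y ∈ S 0 ∩ T l →
      x' ∈ S 1 ∩ T j' → y' ∈ S 1 ∩ T l' → G.Adj x x' → G.Adj y y' → G.Adj x y →
      ¬ G.Adj x' y' := fun hx hy hx' hy' hxx' hyy' hxy hxy' =>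
    hne01 hy hx' (h.eq_of_common_neighbor (hne01 hx hy') hxy hyy' hxx' hxy')
  have hss : ∀ j l, j ≠ l →
      ¬ (r j l = true ∧ r l j = true ∧ r' j l = true ∧ r' l j = true) := by
    rintro j l hjl ⟨e1, e2, e3, e4⟩
    have a := hr j l hjl
    have a' := hr' j l hjl
    rw [e1, e2] at a
    rw [e3, e4] at a'
    exact quad (hs j) (hs l) (hs' j) (hs' l) (hss' j) (hss' l) a a'
  have hσ2 : ∀ j, σ (σ j) ≠ j := fun j e => by
    have e1 := hσr (σ j)
    have e2 := hσr' (σ j)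
    rw [e] at e1 e2
    exact hss j (σ j) (hσj j).symm ⟨hσr j, e1, e2, hσr' j⟩
  obtain ⟨e, he, heσ⟩ := exists_cyclic_labelling hσinj hσj hσ2
  have hbij : Function.Bijective e := Finite.injective_iff_bijective.1 he
  have hcount : ∀ q : Fin 5 → Fin 5 → Bool,
      (∀ j, (Finset.univ.filter fun l => l ≠ j ∧ q j l = true).card = 2) →
      ∀ j, (Finset.univ.filter fun l => l ≠ j ∧ q (e j) (e l) = true).card = 2 :=
    fun q hq j => by
      rw [← hq (e j), ← Finset.card_map (Equiv.ofBijective e hbij).toEmbedding]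
      congr 1
      ext l
      obtain ⟨l, rfl⟩ := hbij.2 l
      simp [he.eq_iff]
  have htriple : ∀ q : Fin 5 → Fin 5 → Bool, IsTripleFree q →
      IsTripleFree fun j l => q (e j) (e l) := fun q hq j l hjl n hjn hln =>
    hq _ _ (he.ne hjl) _ (he.ne hjn) (he.ne hln)
  refine not_isCompatible (r := fun j l => r (e j) (e l)) (r' := fun j l => r' (e j) (e l))
    (fun j => ?_) (fun j => ?_) (hcount r hrc) (hcount r' hrc') (htriple r hrt) (htriple r' hrt')
    fun j l hjl => ⟨hss _ _ (he.ne hjl), ?_, fun hjl' => ?_⟩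
  · simp only [← heσ, hσr]
  · simp only [← heσ, hσr']
  · rintro ⟨e1, e2, e3, e4⟩
    dsimp only at e1 e2 e3 e4
    have a := hr _ _ (he.ne hjl)
    have a' := hr' (σ (e j)) (σ (e l)) (hσinj.ne (he.ne hjl))
    rw [← heσ, ← heσ] at e3 e4
    rw [e1, e2] at a
    rw [e3, e4] at a'
    exact quad (hm _) (hm _) (hm' _) (hm' _) (hmm _) (hmm _) a a'
  · rintro ⟨e1, e2, e3, e4⟩
    dsimp only at e1 e2 e3 e4
    have hjl' := he.ne hjl'
    rw [← heσ] at e3 e4 hjl'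
    have a := hr _ _ (he.ne hjl)
    have a' := hr' _ _ hjl'
    rw [e1, e2] at a
    rw [e3, e4] at a'
    exact quad (hs _) (hm _) (hs' _) (hm' _) (hss' _) (hmm _) a a'

end SimpleGraph

/-- Robertson's graph is strongly regular with parameters `(50, 7, 0, 1)`, and every strongly regular
graph with these parameters has smallest eigenvalue `-3` and is not `2`-integrable. -/
theorem theorem6p3 :
    hoffmanSingleton.IsSRGWith 50 7 0 1 ∧
      ∀ (V : Type*) [Fintype V] [DecidableEq V] (G : SimpleGraph V) [DecidableRel G.Adj],
        G.IsSRGWith 50 7 0 1 →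
          IsLeast G.graphEigenvalues (-3) ∧ ¬ G.IsIntegrable 2 := by
  refine ⟨hoffmanSingleton_isSRGWith, fun V _ _ G _ h => ⟨h.isLeast_graphEigenvalues, fun hi => ?_⟩⟩
  obtain ⟨m, u, hu⟩ := h.exists_int_vectors hi
  obtain ⟨u, w, hf⟩ := h.exists_isIntegralFrame hu
  obtain ⟨S, T, hS, hT, hSd, hTd, hST⟩ := hf.exists_grid h
  exact h.not_isPetersenGrid S T ⟨hS, hT, hSd, hTd, hST⟩
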